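/- For a group $G$ write $x^y=y^{-1}xy$ and $[x,y]=x^{-1}y^{-1}xy$. Let $G\wedge G$ be the nonabelian exterior square of $G$, i.e. the group generated by the symbols $x\wedge y$ $(x,y\in G)$ subject to the relations $$xy\wedge z=(x^y\wedge z^y)(y\wedge z),\qquad x\wedge yz=(x\wedge z)(x^z\wedge y^z),\qquad x\wedge x=1\qquad(x,y,z\in G).$$ Let $\mathrm M_0(G)=\langle x\wedge y \mid x,y\in G,\ [x,y]=1\rangle$, a normal subgroup of $G\wedge G$, and let the Bogomolov multiplier $\mathrm B_0(G)$ be the kernel of the homomorphism $(G\wedge G)/\mathrm M_0(G)\to[G,G]$ induced by $x\wedge y\mapsto[x,y]$. A finite group $G$ is called $\mathrm B_0$-minimal if $\mathrm B_0(G)\neq 0$, $\mathrm B_0(H)=0$ for every proper subgroup $H$ of $G$, and $\mathrm B_0(G/N)=0$ for every nontrivial normal subgroup $N$ of $G$. If $G$ is a $\mathrm B_0$-minimal group, then the exponent of $\mathrm B_0(G)$ is a prime number. -/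

import Mathlib

namespace Bogomolov

variable (G : Type*) [Group G]

section Conventions
variable {G}

/-- Right conjugation `x ^ y = y⁻¹ x y`. -/
def rconj (x y : G) : G := y⁻¹ * x * y

/-- The commutator `[x, y] = x⁻¹ y⁻¹ x y`, in the convention that goes with right conjugation. -/
def rcomm (x y : G) : G := x⁻¹ * y⁻¹ * x * y

end Conventions

/-- The defining relators of the nonabelian exterior square; the generator `(x, y)` of the free
group on `G × G` is the symbol `x ∧ y`. -/
inductive ExteriorRel : FreeGroup (G × G) → Prop
  | mul_left (x y z : G) : ExteriorRel
      (FreeGroup.of (x * y, z) *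
        (FreeGroup.of (rconj x y, rconj z y) * FreeGroup.of (y, z))⁻¹)
  | mul_right (x y z : G) : ExteriorRel
      (FreeGroup.of (x, y * z) *
        (FreeGroup.of (x, z) * FreeGroup.of (rconj x z, rconj y z))⁻¹)
  | diag (x : G) : ExteriorRel (FreeGroup.of (x, x))

/-- The nonabelian exterior square `G ∧ G`: the group generated by the symbols `x ∧ y` subject to
`xy ∧ z = (x^y ∧ z^y)(y ∧ z)`, `x ∧ yz = (x ∧ z)(x^z ∧ y^z)` and `x ∧ x = 1`. -/
abbrev ExteriorSquare : Type _ := PresentedGroup {r | ExteriorRel G r}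

section Wedge
variable {G}

/-- The generator `x ∧ y` of `G ∧ G`. -/
def wedge (x y : G) : ExteriorSquare G := PresentedGroup.of (x, y)

theorem wedge_mul_left (x y z : G) :
    wedge (x * y) z = wedge (rconj x y) (rconj z y) * wedge y z :=
  eq_of_mul_inv_eq_one
    (PresentedGroup.one_of_mem (rels := {r | ExteriorRel G r}) (ExteriorRel.mul_left x y z))

theorem wedge_mul_right (x y z : G) :
    wedge x (y * z) = wedge x z * wedge (rconj x z) (rconj y z) :=
  eq_of_mul_inv_eq_one
    (PresentedGroup.one_of_mem (rels := {r | ExteriorRel G r}) (ExteriorRel.mul_right x y z))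

theorem rconj_mul (x y z : G) : rconj (x * y) z = rconj x z * rconj y z := by
  simp only [rconj]; group

theorem rconj_rconj (x y z : G) : rconj (rconj x y) z = rconj x (y * z) := by
  simp only [rconj]; group

/-- Conjugation by `y ∧ w` is the action of `[y, w]` on generators. -/
theorem wedge_conj (x z y w : G) :
    (wedge y w)⁻¹ * wedge x z * wedge y w
      = wedge (rconj x (rcomm y w)) (rconj z (rcomm y w)) := by
  have key : ∀ x z : G, wedge (rconj x (w * y)) (rconj z (w * y)) * wedge y w
      = wedge y w * wedge (rconj x (y * w)) (rconj z (y * w)) := by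
    intro x z
    have h1 : wedge (x * y) (z * w) = wedge (rconj x y) (rconj w y) *
        (wedge (rconj x (w * y)) (rconj z (w * y))) *
          (wedge y w * wedge (rconj y w) (rconj z w)) := by
      rw [wedge_mul_left, rconj_mul, wedge_mul_right, wedge_mul_right]
      have e : y * rconj w y = w * y := by simp only [rconj]; group
      rw [rconj_rconj, rconj_rconj, e]
    have h2 : wedge (x * y) (z * w) = wedge (rconj x y) (rconj w y) * wedge y w *
        (wedge (rconj x (y * w)) (rconj z (y * w)) * wedge (rconj y w) (rconj z w)) := by
      rw [wedge_mul_right, wedge_mul_left, rconj_mul, wedge_mul_left]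
      have e : w * rconj y w = y * w := by simp only [rconj]; group
      rw [rconj_rconj, rconj_rconj, e]
    have h := h1.symm.trans h2
    simp only [mul_assoc, mul_right_inj] at h
    simpa only [← mul_assoc, mul_left_inj] using h
  have h := key (rconj x (w * y)⁻¹) (rconj z (w * y)⁻¹)
  simp only [rconj_rconj] at h
  have e1 : (w * y)⁻¹ * (w * y) = 1 := by group
  have e2 : (w * y)⁻¹ * (y * w) = rcomm y w := by simp only [rcomm]; group
  have e3 : ∀ g : G, rconj g 1 = g := fun g => by simp [rconj]
  rw [e1, e2, e3, e3] at h
  rw [mul_assoc, h, inv_mul_cancel_left]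

theorem rconj_eq_conj (x g : G) : rconj x g = MulAut.conj g⁻¹ x := by
  simp [rconj]

theorem rcomm_rconj (x y g : G) : rcomm (rconj x g) (rconj y g) = rconj (rcomm x y) g := by
  simp only [rconj, rcomm]; group

end Wedge

/-- `M₀(G) = ⟨x ∧ y | [x, y] = 1⟩`. -/
def M0 : Subgroup (ExteriorSquare G) :=
  Subgroup.closure {t | ∃ x y : G, rcomm x y = 1 ∧ wedge x y = t}

instance M0_normal : (M0 G).Normal := by
  have hconj : ∀ y w : G, ∀ n ∈ M0 G,
      wedge y w * n * (wedge y w)⁻¹ ∈ M0 G ∧ (wedge y w)⁻¹ * n * wedge y w ∈ M0 G := by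
    intro y w n hn
    induction hn using Subgroup.closure_induction with
    | mem t ht =>
      obtain ⟨a, b, hab, rfl⟩ := ht
      constructor
      · have h := wedge_conj (rconj a (rcomm y w)⁻¹) (rconj b (rcomm y w)⁻¹) y w
        simp only [rconj_rconj, inv_mul_cancel] at h
        have e3 : ∀ g : G, rconj g 1 = g := fun g => by simp [rconj]
        rw [e3, e3] at h
        rw [← h]
        have : wedge y w * ((wedge y w)⁻¹ *
            wedge (rconj a (rcomm y w)⁻¹) (rconj b (rcomm y w)⁻¹) * wedge y w) *
            (wedge y w)⁻¹ = wedge (rconj a (rcomm y w)⁻¹) (rconj b (rcomm y w)⁻¹) := by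
          group
        rw [this]
        exact Subgroup.subset_closure ⟨_, _, by rw [rcomm_rconj, hab]; simp [rconj], rfl⟩
      · rw [wedge_conj]
        exact Subgroup.subset_closure ⟨_, _, by rw [rcomm_rconj, hab]; simp [rconj], rfl⟩
    | one => simp [(M0 G).one_mem]
    | mul a b _ _ ha hb =>
      constructor
      · have := (M0 G).mul_mem ha.1 hb.1
        simpa [mul_assoc] using this
      · have := (M0 G).mul_mem ha.2 hb.2
        simpa [mul_assoc] using this
    | inv a _ ha =>
      constructor
      · have := (M0 G).inv_mem ha.1
        simpa [mul_assoc] using this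
      · have := (M0 G).inv_mem ha.2
        simpa [mul_assoc] using this
  have htop : ∀ g : ExteriorSquare G, ∀ n ∈ M0 G, g * n * g⁻¹ ∈ M0 G ∧ g⁻¹ * n * g ∈ M0 G := by
    intro g
    have hg : g ∈ Subgroup.closure
        (Set.range (PresentedGroup.of (rels := {r | ExteriorRel G r}))) := by
      rw [PresentedGroup.closure_range_of]; exact Subgroup.mem_top g
    induction hg using Subgroup.closure_induction with
    | mem t ht =>
      obtain ⟨⟨y, w⟩, rfl⟩ := ht
      exact hconj y w
    | one => intro n hn; simpa using hn
    | mul a b _ _ ha hb =>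
      intro n hn
      constructor
      · simpa [mul_assoc] using (ha _ (hb n hn).1).1
      · simpa [mul_assoc] using (hb _ (ha n hn).2).2
    | inv a _ ha =>
      intro n hn
      exact ⟨by simpa using (ha n hn).2, by simpa using (ha n hn).1⟩
  exact ⟨fun n hn g => (htop g n hn).1⟩

/-- The commutator map `G ∧ G → G`, `x ∧ y ↦ [x, y]`; its image is `[G, G]`. -/
def commutatorMap : ExteriorSquare G →* G :=
  PresentedGroup.toGroup (f := fun q : G × G => rcomm q.1 q.2) (by
    rintro r (⟨x, y, z⟩ | ⟨x, y, z⟩ | ⟨x⟩) <;>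
      simp only [map_mul, map_inv, FreeGroup.lift_apply_of, rcomm, rconj] <;> group)

theorem commutatorMap_wedge (x y : G) : commutatorMap G (wedge x y) = rcomm x y :=
  PresentedGroup.toGroup.of _

/-- `G ⋏ G = (G ∧ G) / M₀(G)`. -/
abbrev CurlyWedge : Type _ := ExteriorSquare G ⧸ M0 G

/-- The commutator map `G ⋏ G → G` induced by `x ∧ y ↦ [x, y]`. -/
def curlyCommutatorMap : CurlyWedge G →* G :=
  QuotientGroup.lift (M0 G) (commutatorMap G) (by
    have h : M0 G ≤ (commutatorMap G).ker := by
      rw [M0, Subgroup.closure_le]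
      rintro _ ⟨x, y, hxy, rfl⟩
      exact (commutatorMap_wedge G x y).trans hxy
    exact fun x hx => h hx)

/-- The Bogomolov multiplier `B₀(G)`: the kernel of the commutator map `G ⋏ G → [G, G]`
(equivalently, the quotient of `ker (G ∧ G → [G, G])` by `M₀(G)`). -/
def B0 : Subgroup (CurlyWedge G) := (curlyCommutatorMap G).ker

/-- A finite group is `B₀`-minimal if its Bogomolov multiplier is nontrivial, while those of all
its proper subgroups and of all its proper quotients are trivial. -/
structure IsB0Minimal : Prop where
  finite : Finite G
  nontrivial : Nontrivial (B0 G)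
  subgroup : ∀ H : Subgroup G, H ≠ ⊤ → Subsingleton (B0 H)
  quotient : ∀ (N : Subgroup G) [N.Normal], N ≠ ⊥ → Subsingleton (B0 (G ⧸ N))

end Bogomolov

/-! Two arguments combine. First, a minimal group is a p-group. Embed G⋏G in a group E over G, with
E → G onto, so that G⋏G becomes [E,E] with x∧y the commutator of any lifts of x and y
(`CurlyExtension`, `commutatorElement_eq`). Elements of B₀(G) are then central in E and lie in
[E,E]; transfer to the preimage of P ≤ G sends b to b^[G:P] and also kills b, so b^[G:P] comes from
B₀(P) (`pow_index_eq_one`). Taking P to be a proper Sylow subgroup makes the order of b prime to p.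

Second, take N central of order p. Since B₀(G/N) = 0, all of B₀(G) dies in G/N⋏G/N. What dies there
is accounted for by symbols x∧y with [x,y] ∈ N; these are central, and (x∧y)^p = x^p∧y = 1 because
[x^p,y] = [x,y]^p = 1 (`mem_centralTorsion_of_curlyMap_eq_one`). -/

namespace Bogomolov
universe u v
variable {G : Type u} [Group G]

/-! ### Calculus in G⋏G: universal property, conjugation action, commutator identities. -/

/-- The image of `x ∧ y` in `G ⋏ G`. -/
def curly (x y : G) : CurlyWedge G := QuotientGroup.mk (wedge x y)

theorem curlyCommutatorMap_curly (x y : G) :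
    curlyCommutatorMap G (curly x y) = rcomm x y :=
  commutatorMap_wedge G x y

theorem curly_mul_left_rconj (x y z : G) :
    curly (x * y) z = curly (rconj x y) (rconj z y) * curly y z :=
  congrArg (QuotientGroup.mk' (M0 G)) (wedge_mul_left x y z)

theorem curly_mul_right_rconj (x y z : G) :
    curly x (y * z) = curly x z * curly (rconj x z) (rconj y z) :=
  congrArg (QuotientGroup.mk' (M0 G)) (wedge_mul_right x y z)

theorem curly_eq_one {x y : G} (h : rcomm x y = 1) : curly x y = 1 :=
  (QuotientGroup.eq_one_iff _).2 (Subgroup.subset_closure ⟨x, y, h, rfl⟩)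

theorem rcomm_self (x : G) : rcomm x x = 1 := by simp [rcomm]

theorem rcomm_eq_one_iff {x y : G} : rcomm x y = 1 ↔ Commute x y := by
  unfold rcomm Commute SemiconjBy
  constructor
  · intro h
    have : y * x * (x⁻¹ * y⁻¹ * x * y) = y * x := by rw [h, mul_one]
    rw [← this]; group
  · intro h
    rw [mul_assoc, h]; group

theorem curly_one_left (x : G) : curly 1 x = 1 := curly_eq_one (by simp [rcomm])

theorem curly_one_right (x : G) : curly x 1 = 1 := curly_eq_one (by simp [rcomm])

theorem curlyHom_ext {K : Type v} [Group K] {f g : CurlyWedge G →* K}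
    (h : ∀ x y, f (curly x y) = g (curly x y)) : f = g := by
  apply QuotientGroup.monoidHom_ext
  apply PresentedGroup.ext
  rintro ⟨x, y⟩
  exact h x y

/-- The universal property of `G ⋏ G`. -/
def curlyLift {K : Type v} [Group K] (β : G → G → K)
    (hl : ∀ x y z, β (x * y) z = β (rconj x y) (rconj z y) * β y z)
    (hr : ∀ x y z, β x (y * z) = β x z * β (rconj x z) (rconj y z))
    (hc : ∀ x y, rcomm x y = 1 → β x y = 1) : CurlyWedge G →* K :=
  QuotientGroup.lift (M0 G)
    (PresentedGroup.toGroup (f := fun q : G × G => β q.1 q.2) (by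
      rintro r (⟨x, y, z⟩ | ⟨x, y, z⟩ | ⟨x⟩)
      · simp [hl x y z]
      · simp [hr x y z]
      · simpa using hc x x (rcomm_self x)))
    (by
      intro w hw
      refine (Subgroup.closure_le (MonoidHom.ker _)).2 ?_ hw
      rintro _ ⟨x, y, hxy, rfl⟩
      exact (PresentedGroup.toGroup.of _).trans (hc x y hxy))

theorem curlyLift_curly {K : Type v} [Group K] (β : G → G → K) (hl hr hc) (x y : G) :
    curlyLift β hl hr hc (curly x y) = β x y :=
  (QuotientGroup.lift_mk (M0 G) _ (wedge x y)).trans (PresentedGroup.toGroup.of _)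

theorem map_rconj {H : Type v} [Group H] (f : G →* H) (x y : G) :
    f (rconj x y) = rconj (f x) (f y) := by simp [rconj]

theorem map_rcomm {H : Type v} [Group H] (f : G →* H) (x y : G) :
    f (rcomm x y) = rcomm (f x) (f y) := by simp [rcomm]

/-- Functoriality of `G ⋏ G`. -/
def curlyMap {H : Type v} [Group H] (f : G →* H) : CurlyWedge G →* CurlyWedge H :=
  curlyLift (fun x y => curly (f x) (f y))
    (fun x y z => by simp only [map_mul, map_rconj, curly_mul_left_rconj])
    (fun x y z => by simp only [map_mul, map_rconj, curly_mul_right_rconj])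
    (fun x y h => curly_eq_one (by rw [← map_rcomm, h, map_one]))

theorem curlyMap_curly {H : Type v} [Group H] (f : G →* H) (x y : G) :
    curlyMap f (curly x y) = curly (f x) (f y) :=
  curlyLift_curly _ _ _ _ x y

theorem curlyCommutatorMap_curlyMap {H : Type v} [Group H] (f : G →* H) (w : CurlyWedge G) :
    curlyCommutatorMap H (curlyMap f w) = f (curlyCommutatorMap G w) := by
  have : (curlyCommutatorMap H).comp (curlyMap f) = f.comp (curlyCommutatorMap G) :=
    curlyHom_ext fun x y => by
      simp [curlyMap_curly, curlyCommutatorMap_curly, map_rcomm]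
  exact DFunLike.congr_fun this w

/-- An action by endomorphisms is an action by automorphisms. -/
def mulAutOfEnd {E : Type v} [Group E] (a : G → E →* E) (h1 : a 1 = MonoidHom.id E)
    (hmul : ∀ g h, a (g * h) = (a g).comp (a h)) : G →* MulAut E where
  toFun g := MonoidHom.toMulEquiv (a g) (a g⁻¹) (by rw [← hmul, inv_mul_cancel, h1])
    (by rw [← hmul, mul_inv_cancel, h1])
  map_one' := by ext e; simp [h1]
  map_mul' g h := by ext e; simp [hmul]

/-- The conjugation action of `G` on `G ⋏ G`. -/
def curlyConj : G →* MulAut (CurlyWedge G) :=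
  mulAutOfEnd (fun g => curlyMap (MulAut.conj g).toMonoidHom)
    (curlyHom_ext fun x y => by simp [curlyMap_curly])
    (fun g h => curlyHom_ext fun x y => by simp [curlyMap_curly])

theorem curlyConj_curly (g x y : G) :
    curlyConj g (curly x y) = curly (g * x * g⁻¹) (g * y * g⁻¹) :=
  curlyMap_curly _ x y

theorem curlyConj_inv_curly (g x y : G) :
    curlyConj g⁻¹ (curly x y) = curly (rconj x g) (rconj y g) := by
  rw [curlyConj_curly, inv_inv]; rfl

theorem curly_mul_left (x y z : G) :
    curly (x * y) z = curlyConj y⁻¹ (curly x z) * curly y z := by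
  rw [curlyConj_inv_curly, curly_mul_left_rconj]

theorem curly_mul_right (x y z : G) :
    curly x (y * z) = curly x z * curlyConj z⁻¹ (curly x y) := by
  rw [curlyConj_inv_curly, curly_mul_right_rconj]

theorem curlyCommutatorMap_curlyConj (g : G) (w : CurlyWedge G) :
    curlyCommutatorMap G (curlyConj g w) = g * curlyCommutatorMap G w * g⁻¹ :=
  curlyCommutatorMap_curlyMap _ w

/-- The Peiffer identity for `G ⋏ G → G`. -/
theorem curlyConj_curlyCommutatorMap (w u : CurlyWedge G) :
    curlyConj (curlyCommutatorMap G w) u = w * u * w⁻¹ := by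
  suffices h : curlyConj.comp (curlyCommutatorMap G) = MulAut.conj from
    DFunLike.congr_fun (DFunLike.congr_fun h w) u
  refine curlyHom_ext fun y z => ?_
  apply inv_injective
  have : ((curlyConj (rcomm y z)⁻¹).toMonoidHom : CurlyWedge G →* CurlyWedge G)
      = (MulAut.conj (curly y z)⁻¹).toMonoidHom := curlyHom_ext fun a b => by
    have h := congrArg (QuotientGroup.mk' (M0 G)) (wedge_conj a b y z)
    change curlyConj (rcomm y z)⁻¹ (curly a b) = MulAut.conj (curly y z)⁻¹ (curly a b)
    rw [curlyConj_inv_curly, MulAut.conj_apply, inv_inv]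
    exact h.symm
  ext u
  simpa [curlyCommutatorMap_curly] using DFunLike.congr_fun this u

/-- Expanding xy∧xy = 1 on both sides leaves the y-conjugate of this product. -/
theorem curly_mul_swap (x y : G) : curly x y * curly y x = 1 := by
  have h := curly_eq_one (rcomm_self (x * y))
  rw [curly_mul_left, curly_mul_right x, curly_mul_right y, curly_eq_one (rcomm_self x),
    curly_eq_one (rcomm_self y), map_one, mul_one, one_mul, ← map_mul] at h
  exact (MulEquiv.map_eq_one_iff _).1 h

theorem curly_inv (x y : G) : (curly x y)⁻¹ = curly y x :=
  inv_eq_of_mul_eq_one_right (curly_mul_swap x y)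

theorem curlyConj_self_curly (a x : G) : curlyConj a (curly a x) = curly x a⁻¹ := by
  have h := curly_mul_right x a a⁻¹
  rw [mul_inv_cancel, curly_one_right, inv_inv] at h
  rw [eq_inv_of_mul_eq_one_left h.symm, ← map_inv, curly_inv]

theorem curlyConj_curly_inv_left (x g : G) : curlyConj x⁻¹ (curly x⁻¹ g) = (curly x g)⁻¹ := by
  have h := curly_mul_left x⁻¹ x g
  rw [inv_mul_cancel, curly_one_left] at h
  exact eq_inv_of_mul_eq_one_left h.symm

theorem curlyConj_curly_inv_right (x y : G) : curlyConj y⁻¹ (curly x y⁻¹) = (curly x y)⁻¹ := by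
  have h := curly_mul_right x y⁻¹ y
  rw [inv_mul_cancel, curly_one_right] at h
  exact eq_inv_of_mul_eq_one_right h.symm

theorem curly_rconj_left (x y g : G) :
    curly (rconj x y) g = (curly x y)⁻¹ * curly x g * curlyConj g⁻¹ (curly x y) := by
  have h1 : curly (rconj x y) g = curlyConj y⁻¹ (curly x (y * g * y⁻¹)) := by
    rw [curlyConj_inv_curly]; congr 1; simp only [rconj]; group
  rw [h1, curly_mul_right, curly_mul_right x y g, map_mul, map_mul, map_mul,
    curlyConj_curly_inv_right, ← MulAut.mul_apply, ← map_mul, ← MulAut.mul_apply, ← map_mul]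
  simp [mul_assoc]

theorem curly_rcomm_left (x y g : G) :
    curly (rcomm x y) g = (curly x y)⁻¹ * curlyConj g⁻¹ (curly x y) := by
  have h1 : rcomm x y = x⁻¹ * rconj x y := by simp only [rconj, rcomm]; group
  have h2 : (rconj x y)⁻¹ = (rcomm x y)⁻¹ * x⁻¹ := by simp only [rconj, rcomm]; group
  have h3 : ∀ u, curlyConj (rcomm x y)⁻¹ u = (curly x y)⁻¹ * u * curly x y := fun u => by
    rw [← curlyCommutatorMap_curly, ← map_inv, curlyConj_curlyCommutatorMap, inv_inv]
  rw [h1, curly_mul_left, h2, map_mul, MulAut.mul_apply, curlyConj_curly_inv_left, h3,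
    curly_rconj_left]
  group

/-- Both sides are homomorphisms in w, the right-hand one by the Peiffer identity, so
`curly_rcomm_left` settles it on generators. This supplies `act_inv` for the base of the tower of
extensions. -/
theorem curlyConj_inv_apply (g : G) (w : CurlyWedge G) :
    curlyConj g⁻¹ w = w * curly (curlyCommutatorMap G w) g := by
  let f : CurlyWedge G →* CurlyWedge G :=
    MonoidHom.mk' (fun w => w * curly (curlyCommutatorMap G w) g) fun a b => by
      rw [map_mul, curly_mul_left, ← map_inv, curlyConj_curlyCommutatorMap]
      group
  have : (curlyConj g⁻¹).toMonoidHom = f := curlyHom_ext fun x y => by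
    simp [f, curlyCommutatorMap_curly, curly_rcomm_left]
  exact DFunLike.congr_fun this w


/-! ### Crossed modules extending G⋏G, enlarged until they map onto G. -/

/-- A `G`-crossed module containing `G ⋏ G`, on which `G` acts through `incl (∂ e ⋏ g)`. -/
structure CurlyExtension (G : Type u) [Group G] where
  E : Type u
  [grp : Group E]
  proj : E →* G
  act : G →* MulAut E
  incl : CurlyWedge G →* E
  incl_injective : Function.Injective incl
  proj_act : ∀ g e, proj (act g e) = g * proj e * g⁻¹
  proj_incl : ∀ w, proj (incl w) = curlyCommutatorMap G w
  act_incl : ∀ g w, act g (incl w) = incl (curlyConj g w)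
  act_proj : ∀ e f, act (proj e) f = e * f * e⁻¹
  act_inv : ∀ g e, act g⁻¹ e = e * incl (curly (proj e) g)

attribute [instance] CurlyExtension.grp

/-- `G ⋏ G` itself. -/
def CurlyExtension.base (G : Type u) [Group G] : CurlyExtension G where
  E := CurlyWedge G
  proj := curlyCommutatorMap G
  act := curlyConj
  incl := MonoidHom.id _
  incl_injective := Function.injective_id
  proj_act := curlyCommutatorMap_curlyConj
  proj_incl _ := rfl
  act_incl _ _ := rfl
  act_proj := curlyConj_curlyCommutatorMap
  act_inv := curlyConj_inv_apply

namespace CurlyExtension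
variable (X : CurlyExtension G) (x : G)

/-- The action of `ℤ` on `X` through a fixed element of `G`. -/
def zact : Multiplicative ℤ →* MulAut X.E := X.act.comp (zpowersHom G x)

/-- The underlying group of the extension obtained by adjoining a free preimage of `x`. -/
abbrev Adjoin : Type u := X.E ⋊[X.zact x] Multiplicative ℤ

/-- The adjoined preimage of `x`. -/
def gen : X.Adjoin x := SemidirectProduct.inr (Multiplicative.ofAdd 1)

variable {X x}

theorem adjoinHom_ext {H : Type*} [Group H] {f g : X.Adjoin x →* H}
    (hl : ∀ e, f (SemidirectProduct.inl e) = g (SemidirectProduct.inl e))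
    (hr : f (X.gen x) = g (X.gen x)) : f = g :=
  SemidirectProduct.hom_ext (MonoidHom.ext hl) (MonoidHom.ext_mint hr)

theorem zact_apply (n : Multiplicative ℤ) : X.zact x n = X.act (zpowersHom G x n) := rfl

variable (X x)

/-- The projection of the extended group. -/
def adjoinProj : X.Adjoin x →* G :=
  SemidirectProduct.lift X.proj (zpowersHom G x) fun n => by
    ext e
    exact X.proj_act _ e

theorem adjoinProj_inl (e : X.E) : X.adjoinProj x (SemidirectProduct.inl e) = X.proj e :=
  SemidirectProduct.lift_inl _ _ _ _

theorem adjoinProj_gen : X.adjoinProj x (X.gen x) = x := by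
  simp [adjoinProj, gen, zpowersHom_apply]

theorem conj_inl (u : X.Adjoin x) (e : X.E) :
    u * SemidirectProduct.inl e * u⁻¹
      = SemidirectProduct.inl (X.act (X.adjoinProj x u) e) := by
  suffices h : ∀ (a : X.E) (n : Multiplicative ℤ),
      (SemidirectProduct.inl a * SemidirectProduct.inr n : X.Adjoin x) *
        SemidirectProduct.inl e * (SemidirectProduct.inl a * SemidirectProduct.inr n)⁻¹
      = SemidirectProduct.inl (X.act (X.adjoinProj x
        (SemidirectProduct.inl a * SemidirectProduct.inr n)) e) by
    have := h u.left u.right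
    rwa [SemidirectProduct.inl_left_mul_inr_right] at this
  intro a n
  have h1 := SemidirectProduct.inl_aut (φ := X.zact x) n e
  have h2 : X.adjoinProj x (SemidirectProduct.inr n) = zpowersHom G x n :=
    SemidirectProduct.lift_inr _ _ _ _
  rw [map_mul, adjoinProj_inl, h2, map_mul, MulAut.mul_apply, X.act_proj, ← zact_apply,
    map_mul, map_mul, h1, map_inv]
  simp [mul_assoc]

/-- The endomorphism by which `g` acts on the extended group. -/
def adjoinEnd (g : G) : X.Adjoin x →* X.Adjoin x :=
  SemidirectProduct.lift (SemidirectProduct.inl.comp (X.act g).toMonoidHom)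
    -- This image of the generator is forced by `act_inv` at g⁻¹; it lies over g x g⁻¹.
    (zpowersHom _ (X.gen x * SemidirectProduct.inl (X.incl (curly x g⁻¹)))) fun n => by
    ext1 e
    have hs : X.adjoinProj x (X.gen x * SemidirectProduct.inl (X.incl (curly x g⁻¹)))
        = g * x * g⁻¹ := by
      rw [map_mul, adjoinProj_gen, adjoinProj_inl, X.proj_incl, curlyCommutatorMap_curly, rcomm]
      group
    change SemidirectProduct.inl (X.act g (X.act (zpowersHom G x n) e)) = _ *
      SemidirectProduct.inl (X.act g e) * _⁻¹
    rw [conj_inl, zpowersHom_apply, zpowersHom_apply, map_zpow (X.adjoinProj x), hs, ← MulAut.mul_apply,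
      ← map_mul, ← MulAut.mul_apply, ← map_mul, conj_zpow]
    congr 3
    group

theorem adjoinEnd_inl (g : G) (e : X.E) :
    X.adjoinEnd x g (SemidirectProduct.inl e) = SemidirectProduct.inl (X.act g e) :=
  SemidirectProduct.lift_inl _ _ _ _

theorem adjoinEnd_gen (g : G) : X.adjoinEnd x g (X.gen x)
    = X.gen x * SemidirectProduct.inl (X.incl (curly x g⁻¹)) := by
  simp [adjoinEnd, gen, zpowersHom_apply]

/-- The action of `G` on the extended group. -/
def adjoinAct : G →* MulAut (X.Adjoin x) :=
  mulAutOfEnd (X.adjoinEnd x)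
    (adjoinHom_ext (fun e => by simp [adjoinEnd_inl])
      (by simp [adjoinEnd_gen, curly_one_right]))
    (fun g h => adjoinHom_ext (fun e => by simp [adjoinEnd_inl]) (by
      rw [MonoidHom.comp_apply, adjoinEnd_gen, adjoinEnd_gen, map_mul, adjoinEnd_gen,
        adjoinEnd_inl, X.act_incl, mul_inv_rev, curly_mul_right, inv_inv, map_mul, map_mul,
        mul_assoc]))

theorem adjoinAct_inl (g : G) (e : X.E) :
    X.adjoinAct x g (SemidirectProduct.inl e) = SemidirectProduct.inl (X.act g e) :=
  X.adjoinEnd_inl x g e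

theorem adjoinAct_gen (g : G) : X.adjoinAct x g (X.gen x)
    = X.gen x * SemidirectProduct.inl (X.incl (curly x g⁻¹)) :=
  X.adjoinEnd_gen x g

/-- Both sides are multiplicative in u and in v, and `conj_inl` covers v in the old group. What
remains is v the new generator, with u old (from `act_inv`) or u the generator itself (from x∧x⁻¹ =
1). -/
theorem adjoinAct_adjoinProj (u v : X.Adjoin x) :
    X.adjoinAct x (X.adjoinProj x u) v = u * v * u⁻¹ := by
  suffices h : (X.adjoinAct x).comp (X.adjoinProj x) = MulAut.conj from
    DFunLike.congr_fun (DFunLike.congr_fun h u) v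
  have ext' : ∀ a : X.Adjoin x,
      X.adjoinAct x (X.adjoinProj x a) (X.gen x) = a * X.gen x * a⁻¹ →
      (X.adjoinAct x).comp (X.adjoinProj x) a = MulAut.conj a := by
    intro a ha
    have : ((X.adjoinAct x (X.adjoinProj x a)).toMonoidHom : X.Adjoin x →* X.Adjoin x)
        = (MulAut.conj a).toMonoidHom :=
      adjoinHom_ext (fun e => (X.adjoinAct_inl x _ e).trans (X.conj_inl x a e).symm) ha
    ext1 v
    exact DFunLike.congr_fun this v
  refine adjoinHom_ext (fun e => ext' _ ?_) (ext' _ ?_)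
  · have h1 := X.conj_inl x (X.gen x)⁻¹ e
    rw [map_inv, adjoinProj_gen, X.act_inv, inv_inv] at h1
    have h2 : SemidirectProduct.inl e * X.gen x = X.gen x *
        SemidirectProduct.inl (e * X.incl (curly (X.proj e) x)) := by
      rw [← h1]; group
    rw [adjoinAct_gen, adjoinProj_inl, h2, ← curlyConj_self_curly, ← X.act_incl, X.act_proj,
      map_mul, map_inv, mul_assoc]
  · rw [adjoinAct_gen, adjoinProj_gen, curly_eq_one (by simp [rcomm])]
    simp

theorem adjoinAct_inv (g : G) (u : X.Adjoin x) : X.adjoinAct x g⁻¹ u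
    = u * SemidirectProduct.inl (X.incl (curly (X.adjoinProj x u) g)) := by
  let f : X.Adjoin x →* X.Adjoin x := MonoidHom.mk'
    (fun u => u * SemidirectProduct.inl (X.incl (curly (X.adjoinProj x u) g))) fun a b => by
      rw [map_mul, curly_mul_left, map_mul, map_mul, ← X.act_incl, ← map_inv, ← conj_inl]
      group
  have : ((X.adjoinAct x g⁻¹).toMonoidHom : X.Adjoin x →* X.Adjoin x) = f :=
    adjoinHom_ext
      (fun e => (X.adjoinAct_inl x _ e).trans (by rw [X.act_inv]; simp [f, adjoinProj_inl]))
      ((X.adjoinAct_gen x _).trans (by simp [f, adjoinProj_gen]))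
  exact DFunLike.congr_fun this u

/-- Adjoining a free preimage of `x`. -/
def adjoin : CurlyExtension G where
  E := X.Adjoin x
  proj := X.adjoinProj x
  act := X.adjoinAct x
  incl := SemidirectProduct.inl.comp X.incl
  incl_injective := SemidirectProduct.inl_injective.comp X.incl_injective
  proj_act g e := by
    suffices h : (X.adjoinProj x).comp (X.adjoinAct x g).toMonoidHom
        = (MulAut.conj g).toMonoidHom.comp (X.adjoinProj x) from DFunLike.congr_fun h e
    refine adjoinHom_ext (fun e => ?_) ?_
    · change X.adjoinProj x (X.adjoinAct x g _) = g * X.adjoinProj x _ * g⁻¹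
      rw [adjoinAct_inl, adjoinProj_inl, adjoinProj_inl, X.proj_act]
    · change X.adjoinProj x (X.adjoinAct x g _) = g * X.adjoinProj x _ * g⁻¹
      rw [adjoinAct_gen, map_mul, adjoinProj_gen, adjoinProj_inl, X.proj_incl,
        curlyCommutatorMap_curly, rcomm]
      group
  proj_incl w := (X.adjoinProj_inl x _).trans (X.proj_incl w)
  act_incl g w := (X.adjoinAct_inl x g _).trans
    (congrArg SemidirectProduct.inl (X.act_incl g w))
  act_proj := X.adjoinAct_adjoinProj x
  act_inv := X.adjoinAct_inv x

/-- Finiteness of G lets finitely many adjunctions, starting from G⋏G, reach every element. -/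
theorem exists_proj_surjective [Finite G] :
    ∃ X : CurlyExtension G, Function.Surjective X.proj := by
  classical
  have := Fintype.ofFinite G
  have h : ∀ s : Finset G, ∃ X : CurlyExtension G, ∀ x ∈ s, ∃ e, X.proj e = x := by
    intro s
    induction s using Finset.induction_on with
    | empty => exact ⟨base G, by simp⟩
    | insert a s _ ih =>
      obtain ⟨X, hX⟩ := ih
      refine ⟨X.adjoin a, fun x hx => ?_⟩
      rcases Finset.mem_insert.1 hx with rfl | hx
      · exact ⟨X.gen x, X.adjoinProj_gen x⟩
      · obtain ⟨e, rfl⟩ := hX x hx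
        exact ⟨SemidirectProduct.inl e, X.adjoinProj_inl a e⟩
  obtain ⟨X, hX⟩ := h Finset.univ
  exact ⟨X, fun x => hX x (Finset.mem_univ x)⟩

variable {X}

/-- The inverse of the image of f acts on e in two ways: as conjugation by f⁻¹ and by the formula
`act_inv`. Comparing them gives the commutator. -/
theorem commutatorElement_eq (e f : X.E) :
    e⁻¹ * f⁻¹ * e * f = X.incl (curly (X.proj e) (X.proj f)) := by
  have h := X.act_inv (X.proj f) e
  rw [← map_inv, X.act_proj, inv_inv] at h
  rw [eq_comm, ← mul_right_inj e, ← h]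
  group

end CurlyExtension

/-! ### Transfer and the reduction to p-groups. -/

theorem mem_B0 {w : CurlyWedge G} : w ∈ B0 G ↔ curlyCommutatorMap G w = 1 := Iff.rfl

theorem eq_one_of_subsingleton_B0 (h : Subsingleton (B0 G)) {w : CurlyWedge G}
    (hw : curlyCommutatorMap G w = 1) : w = 1 :=
  congrArg Subtype.val (Subsingleton.elim (⟨w, hw⟩ : B0 G) 1)

theorem CurlyExtension.exists_curlyMap_of_mem_commutator (X : CurlyExtension G) (P : Subgroup G)
    (a : P.comap X.proj) (ha : a ∈ commutator (P.comap X.proj)) :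
    ∃ w : CurlyWedge P, X.incl (curlyMap P.subtype w) = a := by
  suffices h : commutator (P.comap X.proj) ≤
      ((X.incl.comp (curlyMap P.subtype)).range).comap (P.comap X.proj).subtype from h ha
  rw [commutator_def, Subgroup.commutator_le]
  rintro e - f -
  have he : X.proj (e : X.E)⁻¹ ∈ P := by rw [map_inv]; exact P.inv_mem e.2
  have hf : X.proj (f : X.E)⁻¹ ∈ P := by rw [map_inv]; exact P.inv_mem f.2
  refine ⟨curly ⟨_, he⟩ ⟨_, hf⟩, ?_⟩
  rw [MonoidHom.comp_apply, curlyMap_curly]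
  refine (CurlyExtension.commutatorElement_eq (e : X.E)⁻¹ (f : X.E)⁻¹).symm.trans ?_
  simp [commutatorElement_def]

theorem CurlyExtension.incl_mem_commutator (X : CurlyExtension G)
    (hX : Function.Surjective X.proj) (w : CurlyWedge G) : X.incl w ∈ commutator X.E := by
  suffices h : (QuotientGroup.mk' (commutator X.E)).comp X.incl = 1 from
    (QuotientGroup.eq_one_iff _).1 (DFunLike.congr_fun h w)
  refine curlyHom_ext fun x y => ?_
  obtain ⟨e, rfl⟩ := hX x
  obtain ⟨f, rfl⟩ := hX y
  rw [MonoidHom.comp_apply, ← CurlyExtension.commutatorElement_eq]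
  refine (QuotientGroup.eq_one_iff _).2 ?_
  have := Subgroup.commutator_mem_commutator (Subgroup.mem_top e⁻¹) (Subgroup.mem_top f⁻¹)
  rw [commutatorElement_def, inv_inv, inv_inv] at this
  exact this

/-- A transfer argument: if `B₀(P) = 0` then `B₀(G)` is annihilated by the index of `P`. -/
theorem pow_index_eq_one [Finite G] (P : Subgroup G) (hP : Subsingleton (B0 P))
    {b : CurlyWedge G} (hb : curlyCommutatorMap G b = 1) : b ^ P.index = 1 := by
  obtain ⟨X, hX⟩ := CurlyExtension.exists_proj_surjective (G := G)
  have hindex : (P.comap X.proj).index = P.index := Subgroup.index_comap_of_surjective P hX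
  have : (P.comap X.proj).FiniteIndex := ⟨by rw [hindex]; exact Subgroup.index_ne_zero_of_finite⟩
  -- Conjugation by b is the action of its image in G, which is 1.
  have hcentral : ∀ f : X.E, Commute f (X.incl b) := fun f => by
    have h := X.act_proj (X.incl b) f
    rw [X.proj_incl, hb, map_one, MulAut.one_apply] at h
    exact eq_mul_inv_iff_mul_eq.1 h
  have htransfer := MonoidHom.transfer_eq_pow (H := P.comap X.proj)
    (Abelianization.of (G := P.comap X.proj)) (X.incl b) fun k g _ => by
      rw [mul_assoc, ← ((hcentral g).pow_right k).eq, inv_mul_cancel_left]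
  -- The transfer has abelian target, so it kills b ∈ [E,E]; by centrality its value is the class of
  -- b^[G:P], which therefore lies in the commutator subgroup of the preimage of P.
  have hone := Abelianization.commutator_subset_ker
    (MonoidHom.transfer (Abelianization.of (G := P.comap X.proj))) (X.incl_mem_commutator hX b)
  rw [MonoidHom.mem_ker, htransfer, ← MonoidHom.mem_ker, Abelianization.ker_of] at hone
  obtain ⟨w, hw⟩ := X.exists_curlyMap_of_mem_commutator P _ hone
  have hw1 : w = 1 := by
    apply eq_one_of_subsingleton_B0 hP
    apply P.subtype_injective
    rw [map_one, ← curlyCommutatorMap_curlyMap, ← X.proj_incl, hw]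
    change X.proj (X.incl b ^ _) = 1
    rw [map_pow, X.proj_incl, hb, one_pow]
  apply X.incl_injective
  rw [hw1, map_one, map_one] at hw
  rw [map_pow, map_one, ← hindex]
  exact hw.symm

theorem subsingleton_B0_of_subsingleton [Subsingleton G] : Subsingleton (B0 G) := by
  have h : MonoidHom.id (CurlyWedge G) = 1 := curlyHom_ext fun x y =>
    curly_eq_one (Subsingleton.elim _ _)
  have h1 : ∀ w : B0 G, w = 1 := fun w => Subtype.ext (DFunLike.congr_fun h w.1)
  exact ⟨fun a b => (h1 a).trans (h1 b).symm⟩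

/-- A `B₀`-minimal group has prime power order. -/
theorem IsB0Minimal.exists_isPGroup (hG : IsB0Minimal G) :
    ∃ p : ℕ, p.Prime ∧ IsPGroup p G := by
  have := hG.finite
  have := hG.nontrivial
  by_contra! hcon
  obtain ⟨b, hb⟩ := exists_ne (1 : B0 G)
  -- A prime p dividing the order of b would divide the index of a Sylow p-subgroup, which is proper
  -- because G is not a p-group.
  refine hb (orderOf_eq_one_iff.1 (Nat.eq_one_iff_not_exists_prime_dvd.2 fun p hp hdvd => ?_))
  have : Fact p.Prime := ⟨hp⟩
  obtain ⟨P⟩ := (inferInstance : Nonempty (Sylow p G))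
  have hP : (P : Subgroup G) ≠ ⊤ := fun h => hcon p hp fun g => by
    obtain ⟨k, hk⟩ := P.isPGroup' ⟨g, h ▸ Subgroup.mem_top g⟩
    exact ⟨k, congrArg Subtype.val hk⟩
  have hpow := pow_index_eq_one (P : Subgroup G) (hG.subgroup _ hP) b.2
  exact P.not_dvd_index (hdvd.trans (orderOf_dvd_of_pow_eq_one (Subtype.ext hpow)))

/-! ### The kernel of G⋏G → G/N⋏G/N for central N. -/

section CentralQuotient

theorem rcomm_eq_one_of_mem_center {c : G} (hc : c ∈ Subgroup.center G) (x : G) :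
    rcomm c x = 1 :=
  rcomm_eq_one_iff.2 (Subgroup.mem_center_iff.1 hc x).symm

theorem rconj_eq_of_mem_center {c : G} (hc : c ∈ Subgroup.center G) (x : G) :
    rconj x c = x := by
  rw [rconj, mul_assoc, Subgroup.mem_center_iff.1 hc x, inv_mul_cancel_left]

theorem curly_center_left {c : G} (hc : c ∈ Subgroup.center G) (x : G) : curly c x = 1 :=
  curly_eq_one (rcomm_eq_one_of_mem_center hc x)

theorem curly_mul_center_left {c : G} (hc : c ∈ Subgroup.center G) (x y : G) :
    curly (x * c) y = curly x y := by
  rw [curly_mul_left_rconj, rconj_eq_of_mem_center hc, rconj_eq_of_mem_center hc,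
    curly_center_left hc, mul_one]

theorem curly_mul_center_right {c : G} (hc : c ∈ Subgroup.center G) (x y : G) :
    curly x (y * c) = curly x y := by
  rw [← curly_inv, curly_mul_center_left hc, curly_inv]

/-- By the Peiffer identity, conjugation by x∧y is the action of [x,y], and a central element of G
acts trivially. -/
theorem curly_mem_center {x y : G} (h : rcomm x y ∈ Subgroup.center G) :
    curly x y ∈ Subgroup.center (CurlyWedge G) := by
  have hact : ((curlyConj (rcomm x y)).toMonoidHom : CurlyWedge G →* CurlyWedge G)
      = MonoidHom.id _ := curlyHom_ext fun a b => by
    have hz : ∀ a, rcomm x y * a * (rcomm x y)⁻¹ = a := fun a => by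
      rw [← Subgroup.mem_center_iff.1 h a, mul_inv_cancel_right]
    change curlyConj (rcomm x y) (curly a b) = curly a b
    rw [curlyConj_curly, hz, hz]
  rw [Subgroup.mem_center_iff]
  intro w
  have h1 : curlyConj (rcomm x y) w = w := DFunLike.congr_fun hact w
  rw [← curlyCommutatorMap_curly, curlyConj_curlyCommutatorMap] at h1
  exact (mul_inv_eq_iff_eq_mul.1 h1).symm

theorem rconj_self_right (x y : G) : rconj y x = y * rcomm y x := by
  simp only [rconj, rcomm]; group

/-- In x^n·x∧y = (x^n∧y^x)(x∧y), the entry y^x = y[y,x] may be replaced by y, since central factors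
do not change a symbol. -/
theorem curly_pow {x y : G} (h : rcomm x y ∈ Subgroup.center G) (n : ℕ) :
    curly x y ^ n = curly (x ^ n) y := by
  have h' : rcomm y x ∈ Subgroup.center G := by
    have : rcomm y x = (rcomm x y)⁻¹ := by simp only [rcomm]; group
    rw [this]; exact inv_mem h
  induction n with
  | zero => rw [pow_zero, pow_zero, curly_one_left]
  | succ n ih =>
    have hx : rconj (x ^ n) x = x ^ n := by
      rw [rconj, mul_assoc, ← pow_succ, pow_succ', inv_mul_cancel_left]
    rw [pow_succ, ih, pow_succ, curly_mul_left_rconj, hx, rconj_self_right,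
      curly_mul_center_right h']

theorem rcomm_pow {x y : G} (h : rcomm x y ∈ Subgroup.center G) (n : ℕ) :
    rcomm (x ^ n) y = rcomm x y ^ n := by
  rw [← curlyCommutatorMap_curly, ← curly_pow h, map_pow, curlyCommutatorMap_curly]

/-- The central elements of a group killed by `n`. -/
def centralTorsion (W : Type*) [Group W] (n : ℕ) : Subgroup W where
  carrier := {w | w ∈ Subgroup.center W ∧ w ^ n = 1}
  one_mem' := ⟨one_mem _, one_pow n⟩
  mul_mem' {a b} ha hb := ⟨mul_mem ha.1 hb.1, by
    rw [Commute.mul_pow (Subgroup.mem_center_iff.1 hb.1 a), ha.2, hb.2, one_mul]⟩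
  inv_mem' {a} ha := ⟨inv_mem ha.1, by rw [inv_pow, ha.2, inv_one]⟩

instance centralTorsion_normal (W : Type*) [Group W] (n : ℕ) : (centralTorsion W n).Normal :=
  ⟨fun w hw g => by rwa [Subgroup.mem_center_iff.1 hw.1 g, mul_inv_cancel_right]⟩

variable (N : Subgroup G) [N.Normal] (n : ℕ)

/-- For central `N` of exponent dividing `n`, the kernel of `G ⋏ G → G/N ⋏ G/N` consists of
central elements killed by `n`. -/
theorem mem_centralTorsion_of_curlyMap_eq_one (hN : N ≤ Subgroup.center G)
    (hn : ∀ c ∈ N, c ^ n = 1) {w : CurlyWedge G} (hw : curlyMap (QuotientGroup.mk' N) w = 1) :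
    w ∈ centralTorsion (CurlyWedge G) n := by
  let π := QuotientGroup.mk' (centralTorsion (CurlyWedge G) n)
  -- Since N is central, x∧y depends only on cosets, so the choice of representatives is harmless.
  let β : G ⧸ N → G ⧸ N → CurlyWedge G := fun x y => curly x.out y.out
  have hβ : ∀ x y : G, β x y = curly x y := fun x y => by
    obtain ⟨c, hc⟩ := QuotientGroup.mk_out_eq_mul N x
    obtain ⟨d, hd⟩ := QuotientGroup.mk_out_eq_mul N y
    simp only [β]
    rw [hc, hd, curly_mul_center_left (hN c.2), curly_mul_center_right (hN d.2)]
  have hconj : ∀ x y : G, rconj (x : G ⧸ N) (y : G ⧸ N) = ((rconj x y : G) : G ⧸ N) :=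
    fun x y => (map_rconj (QuotientGroup.mk' N) x y).symm
  let f : CurlyWedge (G ⧸ N) →* CurlyWedge G ⧸ centralTorsion (CurlyWedge G) n :=
    curlyLift (fun x y => π (β x y))
      (fun x y z => by
        obtain ⟨x, rfl⟩ := QuotientGroup.mk_surjective x
        obtain ⟨y, rfl⟩ := QuotientGroup.mk_surjective y
        obtain ⟨z, rfl⟩ := QuotientGroup.mk_surjective z
        rw [hconj, hconj, ← QuotientGroup.mk_mul, hβ, hβ, hβ, curly_mul_left_rconj, map_mul])
      (fun x y z => by
        obtain ⟨x, rfl⟩ := QuotientGroup.mk_surjective x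
        obtain ⟨y, rfl⟩ := QuotientGroup.mk_surjective y
        obtain ⟨z, rfl⟩ := QuotientGroup.mk_surjective z
        rw [hconj, hconj, ← QuotientGroup.mk_mul, hβ, hβ, hβ, curly_mul_right_rconj, map_mul])
      -- The only relation that can fail in G⋏G itself: cosets may commute with [x,y] ≠ 1 in N.
      -- Passing to the quotient by `centralTorsion` repairs exactly this.
      (fun x y h => by
        obtain ⟨x, rfl⟩ := QuotientGroup.mk_surjective x
        obtain ⟨y, rfl⟩ := QuotientGroup.mk_surjective y
        have hxy : rcomm x y ∈ N :=
          (QuotientGroup.eq_one_iff _).1 ((map_rcomm (QuotientGroup.mk' N) x y).trans h)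
        rw [hβ]
        refine (QuotientGroup.eq_one_iff _).2 ⟨curly_mem_center (hN hxy), ?_⟩
        rw [curly_pow (hN hxy)]
        exact curly_eq_one (by rw [rcomm_pow (hN hxy), hn _ hxy]))
  have hf : f.comp (curlyMap (QuotientGroup.mk' N)) = π := curlyHom_ext fun x y => by
    rw [MonoidHom.comp_apply, curlyMap_curly]
    exact (curlyLift_curly _ _ _ _ _ _).trans (congrArg π (hβ x y))
  refine (QuotientGroup.eq_one_iff _).1 ?_
  change π w = 1
  rw [← hf, MonoidHom.comp_apply, hw, map_one]

end CentralQuotient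

/-! ### Conclusion: a central subgroup of order p bounds the exponent. -/

theorem IsB0Minimal.exponent_prime (hG : IsB0Minimal G) : (Monoid.exponent (B0 G)).Prime := by
  have := hG.finite
  have hnt := hG.nontrivial
  obtain ⟨p, hp, hpG⟩ := hG.exists_isPGroup
  have : Fact p.Prime := ⟨hp⟩
  have : Nontrivial G := by
    by_contra h
    rw [not_nontrivial_iff_subsingleton] at h
    exact not_subsingleton _ (subsingleton_B0_of_subsingleton (G := G))
  have := hpG.center_nontrivial
  obtain ⟨z, hz⟩ : ∃ z : Subgroup.center G, orderOf z = p :=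
    exists_prime_orderOf_dvd_card' p (by
      obtain ⟨k, hk, h⟩ := (hpG.to_subgroup (Subgroup.center G)).nontrivial_iff_card.1 this
      rw [h]; exact dvd_pow_self p hk.ne')
  let N : Subgroup G := Subgroup.zpowers (z : G)
  have hNc : N ≤ Subgroup.center G := Subgroup.zpowers_le.2 z.2
  have hNn : N.Normal := ⟨fun c hc g => by
    rwa [Subgroup.mem_center_iff.1 (hNc hc) g, mul_inv_cancel_right]⟩
  have hNp : ∀ c ∈ N, c ^ p = 1 := by
    rintro _ ⟨k, rfl⟩
    have hzp : (z : G) ^ p = 1 := by rw [← hz, ← Subgroup.orderOf_coe, pow_orderOf_eq_one]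
    change ((z : G) ^ k) ^ p = 1
    rw [← zpow_natCast, zpow_comm, zpow_natCast, hzp, one_zpow]
  have hN : N ≠ ⊥ := fun h => by
    rw [Subgroup.zpowers_eq_bot, OneMemClass.coe_eq_one] at h
    rw [h, orderOf_one] at hz
    exact hp.one_lt.ne hz
  have hquot := hG.quotient N hN
  have hdvd : Monoid.exponent (B0 G) ∣ p := Monoid.exponent_dvd_of_forall_pow_eq_one fun b => by
    have hb : curlyMap (QuotientGroup.mk' N) (b : CurlyWedge G) = 1 :=
      eq_one_of_subsingleton_B0 hquot (by
        rw [curlyCommutatorMap_curlyMap, mem_B0.1 b.2, map_one])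
    exact Subtype.ext (mem_centralTorsion_of_curlyMap_eq_one N p hNc hNp hb).2
  rcases (Nat.dvd_prime hp).1 hdvd with h | h
  · exact absurd (Monoid.exp_eq_one_iff.1 h) (not_subsingleton _)
  · rwa [h]

end Bogomolov

theorem corollary2p5 {G : Type*} [Group G] (hG : Bogomolov.IsB0Minimal G) :
    (Monoid.exponent (Bogomolov.B0 G)).Prime :=
  hG.exponent_prime
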